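/- Let $q$ be a power of a prime $p$ and let $C_1\subseteq \mathbf{F}_q^n$ be a $k'$-dimensional $\mathbf{F}_q$-linear code of length $n$. Write $C^\perp=\{x\in\mathbf{F}_q^n : \sum_i x_ic_i=0 \text{ for all } c\in C\}$ for the Euclidean dual, and suppose that the subcode $C_2=C_1\cap C_1^\perp$ has dimension $k''$, where $k'+k''<n$. For $S\subseteq \mathbf{F}_q^n$ let $\mathrm{wt}(S)$ be the minimum Hamming weight of a vector in $S$, with $\mathrm{wt}(\emptyset)=\infty$. Then there exist subsystem codes with parameters $$[[n,\;n-(k'+k''),\;k'-k'',\;\mathrm{wt}(C_2^\perp\setminus C_1)]]_q$$ and $$[[n,\;k'-k'',\;n-(k'+k''),\;\mathrm{wt}(C_2^\perp\setminus C_1^\perp)]]_q .$$ Here $\mathbb{C}^{q^n}=(\mathbb{C}^q)^{\otimes n}$ has orthonormal basis $|x\rangle$, $x\in\mathbf{F}_q^n$, and the errors are the operators $X(a)Z(b)$, $a,b\in\mathbf{F}_q^n$, with $X(a)|x\rangle=|x+a\rangle$ and $Z(b)|x\rangle=\omega^{\mathrm{tr}(\sum_i b_ix_i)}|x\rangle$,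 where $\omega=e^{2\pi i/p}$ and $\mathrm{tr}:\mathbf{F}_q\to\mathbf{F}_p$ is the trace; the weight of $X(a)Z(b)$ is the number of $i$ with $(a_i,b_i)\ne(0,0)$. An $[[n,k,r,d]]_q$ subsystem code is a subspace $Q\subseteq\mathbb{C}^{q^n}$ with a (unitary) tensor decomposition $Q=A\otimes B$, $\dim A=q^k$, $\dim B=q^r$, such that every error $E$ of weight less than $d$ is detectable on subsystem $A$, i.e. $PEP|_Q=1_A\otimes G_E$ for some operator $G_E$ on $B$, where $P$ is the orthogonal projection onto $Q$. -/

import Mathlib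

open scoped TensorProduct

namespace QuantumSubsystem

section Classical

variable {F : Type*} [Field F] {n : ℕ}

/-- The Euclidean dual code `C^⊥ = {x | ∑ i, x i * c i = 0 for all c ∈ C}` of a linear code
`C ≤ F^n`. -/
def euclideanDual (C : Submodule F (Fin n → F)) : Submodule F (Fin n → F) where
  carrier := {x | ∀ c ∈ C, x ⬝ᵥ c = 0}
  add_mem' := fun hx hy c hc => by rw [add_dotProduct, hx c hc, hy c hc, add_zero]
  zero_mem' := fun c _ => zero_dotProduct c
  smul_mem' := fun a x hx c hc => by rw [smul_dotProduct, hx c hc, smul_zero]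

/-- The minimum Hamming weight `wt(S)` of the vectors in a set `S ⊆ F^n`; it is `⊤` when `S` is
empty. -/
noncomputable def minWeight [DecidableEq F] (S : Set (Fin n → F)) : ℕ∞ :=
  ⨅ v ∈ S, (hammingNorm v : ℕ∞)

/-- The weight of the error `X(a) Z(b)`: the number of coordinates on which it acts as something
other than the identity, i.e. on which `(a i, b i) ≠ (0, 0)`. -/
def symplecticWeight [DecidableEq F] (a b : Fin n → F) : ℕ :=
  (Finset.univ.filter fun i => a i ≠ 0 ∨ b i ≠ 0).card

end Classical

section Quantum

/-- The Hilbert space `(ℂ^q)^{⊗ n} = ℂ^(q^n)`, with orthonormal basis `|x⟩`, `x ∈ F^n`; the basis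
vector `|x⟩` is `EuclideanSpace.single x 1`. -/
abbrev StateSpace (F : Type*) (n : ℕ) : Type _ := EuclideanSpace ℂ (Fin n → F)

/-- The shift operator `X(a) = X(a_1) ⊗ ⋯ ⊗ X(a_n)`, determined by `X(a)|x⟩ = |x + a⟩`;
in coordinates `(X(a) ψ)(x) = ψ(x - a)`. -/
noncomputable def shiftOp {F : Type*} [Field F] {n : ℕ} (a : Fin n → F) :
    StateSpace F n →ₗ[ℂ] StateSpace F n where
  toFun ψ := WithLp.toLp 2 fun x => ψ (x - a)
  map_add' _ _ := rfl
  map_smul' _ _ := rfl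

/-- The phase operator `Z(b) = Z(b_1) ⊗ ⋯ ⊗ Z(b_n)`, determined by
`Z(b)|x⟩ = ∏ i, ω ^ tr(b_i x_i) |x⟩`, where `ω = exp(2πi/p)` and `tr` is the trace from `F` to
its prime field `𝔽_p`. The character `ZMod.stdAddChar` is `j ↦ ω ^ j`. -/
noncomputable def phaseOp (p : ℕ) [Fact p.Prime] {F : Type*} [Field F] [Algebra (ZMod p) F]
    {n : ℕ} (b : Fin n → F) : StateSpace F n →ₗ[ℂ] StateSpace F n where
  toFun ψ := WithLp.toLp 2 fun x =>
    (∏ i, ZMod.stdAddChar (Algebra.trace (ZMod p) F (b i * x i))) * ψ x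
  map_add' ψ φ := by ext x; simp [mul_add]
  map_smul' c ψ := by ext x; simp [mul_left_comm]

/-- The error operator `X(a) Z(b)`. -/
noncomputable def errorOp (p : ℕ) [Fact p.Prime] {F : Type*} [Field F] [Algebra (ZMod p) F]
    {n : ℕ} (a b : Fin n → F) : StateSpace F n →ₗ[ℂ] StateSpace F n :=
  shiftOp a ∘ₗ phaseOp p b

/-- Let `φ : A ⊗ B ≃ Q` be a unitary identification exhibiting the subspace `Q` of `H` as a tensor
product. The operator `E` on `H` is detectable on subsystem `A` if compressing `E` to `Q` gives an
operator of the form `1_A ⊗ G`: with `P` the orthogonal projection onto `Q`, there is an operator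
`G` on `B` such that `P E φ(x) = φ((1_A ⊗ G) x)` for all `x`. -/
def DetectableOn {A B H : Type*}
    [NormedAddCommGroup A] [InnerProductSpace ℂ A] [NormedAddCommGroup B] [InnerProductSpace ℂ B]
    [NormedAddCommGroup H] [InnerProductSpace ℂ H]
    (Q : Submodule ℂ H) [Q.HasOrthogonalProjection] (φ : (A ⊗[ℂ] B) ≃ₗᵢ[ℂ] Q)
    (E : H →ₗ[ℂ] H) : Prop :=
  ∃ G : B →ₗ[ℂ] B, ∀ x : A ⊗[ℂ] B,
    Q.starProjection (E (φ x : H)) = (φ (TensorProduct.map LinearMap.id G x) : H)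

/-- An `[[n, k, r, d]]_q` subsystem code, `q = |F|`, exists: there is a subspace `Q` of `ℂ^(q^n)`
with a tensor decomposition `Q = A ⊗ B`, `dim A = q^k`, `dim B = q^r`, such that all errors of
weight less than `d` are detectable on subsystem `A`. -/
def ExistsSubsystemCode (p : ℕ) [Fact p.Prime] (F : Type*) [Field F] [Fintype F] [DecidableEq F]
    [Algebra (ZMod p) F] (n k r : ℕ) (d : ℕ∞) : Prop :=
  ∃ (Q : Submodule ℂ (StateSpace F n))
    (φ : (EuclideanSpace ℂ (Fin (Fintype.card F ^ k)) ⊗[ℂ]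
      EuclideanSpace ℂ (Fin (Fintype.card F ^ r))) ≃ₗᵢ[ℂ] Q),
    ∀ a b : Fin n → F, (symplecticWeight a b : ℕ∞) < d → DetectableOn Q φ (errorOp p a b)

end Quantum

end QuantumSubsystem

/-! With `D = C ∩ C^⊥`, split `C = D ⊕ W` and `C^⊥ = D ⊕ W'`. The coset states of `w + w' + D` are
orthonormal; let `Q` be their span, `W'` indexing a basis of `A` and `W` one of `B`. If `a` or `b`
lies outside `D^⊥`, then `X(a)Z(b)` maps `Q` into its orthogonal complement
(`inner_cosetState_errorOp_eq_zero`). Otherwise weight below `wt(D^⊥ \ C)` forces `a, b ∈ C`: the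
shift moves only the `W` label, and the phase does not see `W'` since `b ⊥ C^⊥`, so the error acts
as `1 ⊗ G`. Replacing `C` by `C^⊥` keeps `D` and exchanges `A` and `B`, which gives the second code.
-/

namespace QuantumSubsystem

section Dual

variable {F : Type*} [Field F] {n : ℕ}

/-- The standard dot product as a bilinear form. -/
def dotForm (F : Type*) [Field F] (n : ℕ) : LinearMap.BilinForm F (Fin n → F) :=
  dotProductBilin F F

lemma dotForm_apply (x y : Fin n → F) : dotForm F n x y = x ⬝ᵥ y := rfl

lemma dotForm_isSymm : (dotForm F n).IsSymm := ⟨fun x y => dotProduct_comm x y⟩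

lemma dotForm_nondegenerate : (dotForm F n).Nondegenerate :=
  ⟨fun x hx => dotProduct_eq_zero x hx,
    fun x hx => dotProduct_eq_zero x fun y => (dotProduct_comm x y).trans (hx y)⟩

lemma mem_euclideanDual {C : Submodule F (Fin n → F)} {x : Fin n → F} :
    x ∈ euclideanDual C ↔ ∀ c ∈ C, x ⬝ᵥ c = 0 := Iff.rfl

lemma euclideanDual_eq_orthogonal (C : Submodule F (Fin n → F)) :
    euclideanDual C = (dotForm F n).orthogonal C := by
  ext x
  simp only [mem_euclideanDual, LinearMap.BilinForm.mem_orthogonal_iff, dotForm_apply,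
    dotProduct_comm x]

lemma euclideanDual_euclideanDual (C : Submodule F (Fin n → F)) :
    euclideanDual (euclideanDual C) = C := by
  rw [euclideanDual_eq_orthogonal, euclideanDual_eq_orthogonal,
    LinearMap.BilinForm.orthogonal_orthogonal dotForm_nondegenerate dotForm_isSymm.isRefl]

lemma finrank_euclideanDual (C : Submodule F (Fin n → F)) :
    Module.finrank F (euclideanDual C) = n - Module.finrank F C := by
  rw [euclideanDual_eq_orthogonal, LinearMap.BilinForm.finrank_orthogonal dotForm_nondegenerate,
    Module.finrank_fin_fun]

lemma euclideanDual_anti {C D : Submodule F (Fin n → F)} (h : C ≤ D) :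
    euclideanDual D ≤ euclideanDual C := fun _ hx c hc => hx c (h hc)

/-- A subspace has a complement inside any larger subspace. -/
lemma exists_relative_complement {K V : Type*} [Field K] [AddCommGroup V] [Module K V]
    [FiniteDimensional K V] {D C : Submodule K V} (h : D ≤ C) :
    ∃ W ≤ C, D ⊓ W = ⊥ ∧ D ⊔ W = C ∧
      Module.finrank K W = Module.finrank K C - Module.finrank K D := by
  obtain ⟨W, hW⟩ := D.exists_isCompl
  have h1 : D ⊓ (W ⊓ C) = ⊥ := by rw [← inf_assoc, hW.inf_eq_bot, bot_inf_eq]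
  have h2 : D ⊔ (W ⊓ C) = C := by
    rw [← sup_inf_assoc_of_le W h, hW.sup_eq_top, top_inf_eq]
  refine ⟨W ⊓ C, inf_le_right, h1, h2, ?_⟩
  have := Submodule.finrank_sup_add_finrank_inf_eq D (W ⊓ C)
  rw [h1, h2, finrank_bot] at this
  lia

lemma minWeight_le [DecidableEq F] {S : Set (Fin n → F)} {v : Fin n → F} (hv : v ∈ S) :
    minWeight S ≤ hammingNorm v := iInf₂_le v hv

lemma hammingNorm_left_le_symplecticWeight [DecidableEq F] (a b : Fin n → F) :
    hammingNorm a ≤ symplecticWeight a b :=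
  Finset.card_le_card fun i hi => by
    simp only [Finset.mem_filter] at hi ⊢
    exact ⟨hi.1, Or.inl hi.2⟩

lemma hammingNorm_right_le_symplecticWeight [DecidableEq F] (a b : Fin n → F) :
    hammingNorm b ≤ symplecticWeight a b :=
  Finset.card_le_card fun i hi => by
    simp only [Finset.mem_filter] at hi ⊢
    exact ⟨hi.1, Or.inr hi.2⟩

end Dual

/-! ### The trace character. -/

section Character

variable (p : ℕ) [Fact p.Prime] {F : Type*} [Field F] [Algebra (ZMod p) F] {n : ℕ}

/-- The additive character `t ↦ ω ^ tr(t)` of `F`. -/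
noncomputable def traceChar (F : Type*) [Field F] [Algebra (ZMod p) F] : AddChar F ℂ :=
  ZMod.stdAddChar.compAddMonoidHom (Algebra.trace (ZMod p) F).toAddMonoidHom

lemma prod_stdAddChar_eq_traceChar (b x : Fin n → F) :
    ∏ i, (ZMod.stdAddChar (Algebra.trace (ZMod p) F (b i * x i)) : ℂ) =
      traceChar p F (b ⬝ᵥ x) := by
  exact (map_prod (traceChar p F).toMonoidHom
    (fun i => Multiplicative.ofAdd (b i * x i)) Finset.univ).symm

/-- Nondegeneracy of the trace form, together with the faithfulness of `j ↦ ω ^ j` on `ZMod p`. -/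
lemma exists_traceChar_mul_ne_one [Finite F] {t : F} (ht : t ≠ 0) :
    ∃ s : F, traceChar p F (s * t) ≠ 1 := by
  by_contra! h
  refine ht ((traceForm_nondegenerate (ZMod p) F).1 t fun s => ZMod.injective_stdAddChar ?_)
  rw [Algebra.traceForm_apply, mul_comm, AddChar.map_zero_eq_one]
  exact h s

lemma errorOp_apply (a b : Fin n → F) (ψ : StateSpace F n) (x : Fin n → F) :
    errorOp p a b ψ x = traceChar p F (b ⬝ᵥ (x - a)) * ψ (x - a) := by
  rw [← prod_stdAddChar_eq_traceChar]
  rfl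

end Character

/-! ### Detectability criteria and tensor decompositions. -/

section Detectability

variable {A B H I J : Type*}
  [NormedAddCommGroup A] [InnerProductSpace ℂ A] [NormedAddCommGroup B] [InnerProductSpace ℂ B]
  [NormedAddCommGroup H] [InnerProductSpace ℂ H]
  {Q : Submodule ℂ H} [Q.HasOrthogonalProjection] {φ : (A ⊗[ℂ] B) ≃ₗᵢ[ℂ] Q} {E : H →ₗ[ℂ] H}

/-- An operator that acts on the basis of `A ⊗ B` as `1 ⊗ G` is detectable on `A`. -/
lemma detectableOn_of_apply_basis (bA : Module.Basis I ℂ A) (bB : Module.Basis J ℂ B)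
    (G : B →ₗ[ℂ] B)
    (h : ∀ i j, E (φ (bA i ⊗ₜ bB j) : H) = (φ (bA i ⊗ₜ G (bB j)) : H)) :
    DetectableOn Q φ E := by
  have key : E ∘ₗ Q.subtype ∘ₗ φ.toLinearEquiv.toLinearMap =
      Q.subtype ∘ₗ φ.toLinearEquiv.toLinearMap ∘ₗ TensorProduct.map LinearMap.id G := by
    refine (bA.tensorProduct bB).ext fun ij => ?_
    simpa [Module.Basis.tensorProduct_apply'] using h ij.1 ij.2
  refine ⟨G, fun x => ?_⟩
  have hx : E (φ x : H) = (φ (TensorProduct.map LinearMap.id G x) : H) := LinearMap.congr_fun key x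
  rw [hx, Submodule.starProjection_eq_self_iff]
  exact Subtype.property _

/-- An operator that maps `Q` to its orthogonal complement is detectable. -/
lemma detectableOn_of_inner_basis_eq_zero (bA : Module.Basis I ℂ A) (bB : Module.Basis J ℂ B)
    (h : ∀ i j i' j', inner ℂ (φ (bA i ⊗ₜ bB j) : H) (E (φ (bA i' ⊗ₜ bB j') : H)) = 0) :
    DetectableOn Q φ E := by
  -- The inner product is linear only in its second slot, so vanishing is extended from the basis
  -- one slot at a time, swapping slots in between.
  have left (i' j') (y : A ⊗[ℂ] B) : inner ℂ (E (φ (bA i' ⊗ₜ bB j') : H)) (φ y : H) = 0 := by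
    have : innerₛₗ ℂ (E (φ (bA i' ⊗ₜ bB j') : H)) ∘ₗ Q.subtype ∘ₗ
        φ.toLinearEquiv.toLinearMap = 0 := (bA.tensorProduct bB).ext fun ij => by
      simpa [Module.Basis.tensorProduct_apply'] using
        inner_eq_zero_symm.1 (h ij.1 ij.2 i' j')
    exact LinearMap.congr_fun this y
  have right (x y : A ⊗[ℂ] B) : inner ℂ (φ y : H) (E (φ x : H)) = 0 := by
    have : innerₛₗ ℂ (φ y : H) ∘ₗ E ∘ₗ Q.subtype ∘ₗ φ.toLinearEquiv.toLinearMap = 0 :=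
      (bA.tensorProduct bB).ext fun ij => by
        simpa [Module.Basis.tensorProduct_apply'] using
          inner_eq_zero_symm.1 (left ij.1 ij.2 y)
    exact LinearMap.congr_fun this x
  refine ⟨0, fun x => ?_⟩
  rw [TensorProduct.map_zero_right, LinearMap.zero_apply, map_zero, Submodule.coe_zero,
    Submodule.starProjection_apply_eq_zero_iff, Submodule.mem_orthogonal]
  intro v hv
  obtain ⟨y, hy⟩ := φ.surjective ⟨v, hv⟩
  simpa [hy] using right x y

end Detectability

section TensorDecomposition

variable {A B H I J : Type*}
  [NormedAddCommGroup A] [InnerProductSpace ℂ A] [NormedAddCommGroup B] [InnerProductSpace ℂ B]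
  [NormedAddCommGroup H] [InnerProductSpace ℂ H]

/-- An orthonormal family indexed by a product exhibits its span as a tensor product. -/
lemma exists_tensor_equiv_of_orthonormal [Fintype I] [Fintype J]
    (bA : OrthonormalBasis I ℂ A) (bB : OrthonormalBasis J ℂ B) {u : I × J → H}
    (hu : Orthonormal ℂ u) :
    ∃ (Q : Submodule ℂ H) (φ : (A ⊗[ℂ] B) ≃ₗᵢ[ℂ] Q),
      ∀ i j, (φ (bA i ⊗ₜ bB j) : H) = u (i, j) := by
  let b := bA.tensorProduct bB
  let L₀ : A ⊗[ℂ] B →ₗ[ℂ] H := b.toBasis.constr ℂ u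
  have hL₀ (i j) : L₀ (bA i ⊗ₜ bB j) = u (i, j) := by
    have := b.toBasis.constr_basis ℂ u (i, j)
    rwa [OrthonormalBasis.coe_toBasis, OrthonormalBasis.tensorProduct_apply] at this
  have hL : Orthonormal ℂ (L₀ ∘ b.toBasis) := by
    convert hu using 1
    funext ij
    exact b.toBasis.constr_basis ℂ u ij
  let L : A ⊗[ℂ] B →ₗᵢ[ℂ] H := L₀.isometryOfOrthonormal (by simp) hL
  exact ⟨_, L.equivRange, hL₀⟩

end TensorDecomposition

/-! ### Coset states and the action of errors on them. -/

section CosetState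

open scoped Classical in
/-- The normalized uniform superposition of the vectors of the coset `w + D`. -/
noncomputable def cosetState {F : Type*} [Field F] {n : ℕ}
    (D : Submodule F (Fin n → F)) (w : Fin n → F) : StateSpace F n :=
  WithLp.toLp 2 fun x => if x - w ∈ D then ((√(Nat.card D : ℝ))⁻¹ : ℂ) else 0

variable {F : Type*} [Field F] {n : ℕ} {D : Submodule F (Fin n → F)}

lemma cosetState_apply_of_mem {w x : Fin n → F} (h : x - w ∈ D) :
    cosetState D w x = ((√(Nat.card D : ℝ))⁻¹ : ℂ) := if_pos h

lemma cosetState_apply_of_notMem {w x : Fin n → F} (h : x - w ∉ D) :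
    cosetState D w x = 0 := if_neg h

lemma cosetState_apply_congr {w w' x x' : Fin n → F} (h : (x - w) - (x' - w') ∈ D) :
    cosetState D w x = cosetState D w' x' := by
  by_cases hx : x - w ∈ D
  · rw [cosetState_apply_of_mem hx, cosetState_apply_of_mem]
    simpa using D.sub_mem hx h
  · rw [cosetState_apply_of_notMem hx, cosetState_apply_of_notMem]
    exact fun hx' => hx (by simpa using D.add_mem h hx')

/-- Distinct cosets have disjoint supports, each of size `|D|`. -/
lemma orthonormal_cosetState [Fintype F] {ι : Type*} {w : ι → Fin n → F}
    (hw : ∀ i j, w i - w j ∈ D → i = j) : Orthonormal ℂ fun i => cosetState D (w i) := by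
  classical
  rw [orthonormal_iff_ite]
  intro i j
  rw [PiLp.inner_apply]
  split_ifs with h
  · subst h
    have hcard : ((Finset.univ.filter fun x : Fin n → F => x - w i ∈ D).card) = Nat.card D := by
      rw [← Fintype.card_subtype, ← Nat.card_eq_fintype_card]
      exact Nat.card_congr ((Equiv.subRight (w i)).subtypeEquiv fun x => Iff.rfl)
    have hpos : (0 : ℝ) < Nat.card D := Nat.cast_pos.2 Nat.card_pos
    have hterm (x : Fin n → F) : inner ℂ (cosetState D (w i) x) (cosetState D (w i) x) =
        if x - w i ∈ D then ((Nat.card D : ℂ))⁻¹ else 0 := by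
      split_ifs with hx
      · rw [cosetState_apply_of_mem hx, ← Complex.ofReal_inv, RCLike.inner_apply,
          Complex.conj_ofReal, ← Complex.ofReal_mul, ← mul_inv, Real.mul_self_sqrt hpos.le]
        simp
      · simp [cosetState_apply_of_notMem hx]
    rw [Finset.sum_congr rfl fun x _ => hterm x, ← Finset.sum_filter, Finset.sum_const, hcard,
      nsmul_eq_mul, mul_inv_cancel₀]
    exact_mod_cast hpos.ne'
  · refine Finset.sum_eq_zero fun x _ => ?_
    by_cases hx : x - w i ∈ D
    · have hx' : x - w j ∉ D := fun hx' => h (hw i j (by simpa using D.sub_mem hx' hx))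
      simp [cosetState_apply_of_notMem hx']
    · simp [cosetState_apply_of_notMem hx]

end CosetState

section ErrorsOnCosetStates

variable (p : ℕ) [Fact p.Prime] {F : Type*} [Field F] [Algebra (ZMod p) F] {n : ℕ}
  {D : Submodule F (Fin n → F)}

/-- If `b ∈ D^⊥`, then `Z(b)` acts on coset states of `D` as a phase, and `X(a)` as a
translation. -/
lemma errorOp_cosetState {a b : Fin n → F} (hb : b ∈ euclideanDual D) (w : Fin n → F) :
    errorOp p a b (cosetState D w) = traceChar p F (b ⬝ᵥ w) • cosetState D (w + a) := by
  ext x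
  rw [errorOp_apply, PiLp.smul_apply, smul_eq_mul]
  have hxw : x - (w + a) = x - a - w := by abel
  by_cases hx : x - a - w ∈ D
  · have hbx : b ⬝ᵥ (x - a) = b ⬝ᵥ w := by
      rw [← sub_eq_zero, ← dotProduct_sub]
      exact hb _ hx
    rw [cosetState_apply_of_mem hx, hbx, cosetState_apply_of_mem (hxw ▸ hx)]
  · rw [cosetState_apply_of_notMem hx, cosetState_apply_of_notMem (hxw ▸ hx), mul_zero, mul_zero]

/-- If `X(a) Z(b)` does not commute with the stabilizer `{X(c) Z(c') | c, c' ∈ D}`, then it maps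
the coset states in `D^⊥ / D` to orthogonal ones. -/
lemma inner_cosetState_errorOp_eq_zero [Fintype F] (hD : D ≤ euclideanDual D) {a b : Fin n → F}
    (hab : a ∉ euclideanDual D ∨ b ∉ euclideanDual D) {v w : Fin n → F}
    (hv : v ∈ euclideanDual D) (hw : w ∈ euclideanDual D) :
    inner ℂ (cosetState D v) (errorOp p a b (cosetState D w)) = 0 := by
  by_cases hb : b ∈ euclideanDual D
  -- The shift by `a` leaves `D^⊥`, so the supports are disjoint.
  · have ha : a ∉ euclideanDual D := hab.resolve_right (not_not_intro hb)
    rw [errorOp_cosetState p hb, inner_smul_right, PiLp.inner_apply, Finset.sum_eq_zero, mul_zero]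
    intro x _
    by_cases hx : x - v ∈ D
    · have hx' : x - (w + a) ∉ D := fun hx' => ha <| by
        have := sub_mem (sub_mem (add_mem (hD hx) hv) (hD hx')) hw
        simpa using this
      simp [cosetState_apply_of_notMem hx']
    · simp [cosetState_apply_of_notMem hx]
  -- Translating the summation variable by `s • c ∈ D` fixes both coset states but multiplies the
  -- sum by a character value other than 1, so the sum is 0.
  · obtain ⟨c, hc, hbc⟩ : ∃ c ∈ D, b ⬝ᵥ c ≠ 0 := by simpa [mem_euclideanDual] using hb
    obtain ⟨s, hs⟩ := exists_traceChar_mul_ne_one p hbc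
    have hsc : s • c ∈ D := D.smul_mem s hc
    rw [PiLp.inner_apply]
    set f : (Fin n → F) → ℂ := fun x =>
      inner ℂ (cosetState D v x) (errorOp p a b (cosetState D w) x) with hf
    have hshift (x : Fin n → F) : f (x + s • c) = traceChar p F (s * (b ⬝ᵥ c)) * f x := by
      have h1 : cosetState D v (x + s • c) = cosetState D v x :=
        cosetState_apply_congr (by simpa [add_sub_right_comm] using hsc)
      have h2 : cosetState D w (x + s • c - a) = cosetState D w (x - a) :=
        cosetState_apply_congr (by convert hsc using 1; abel)
      have h3 : b ⬝ᵥ (x + s • c - a) = s * (b ⬝ᵥ c) + b ⬝ᵥ (x - a) := by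
        rw [show x + s • c - a = s • c + (x - a) by abel, dotProduct_add, dotProduct_smul,
          smul_eq_mul]
      simp only [hf, errorOp_apply, h1, h2, h3, AddChar.map_add_eq_mul, RCLike.inner_apply]
      ring
    have hsum : ∑ x, f x = traceChar p F (s * (b ⬝ᵥ c)) * ∑ x, f x := by
      rw [Finset.mul_sum, ← Finset.sum_congr rfl fun x _ => hshift x]
      exact (Equiv.sum_comp (Equiv.addRight (s • c)) f).symm
    by_contra h0
    exact hs (mul_right_cancel₀ h0 (by rw [one_mul, ← hsum]))

end ErrorsOnCosetStates

/-! ### The subsystem code of a linear code. -/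

section Construction

variable (p : ℕ) [Fact p.Prime] {F : Type*} [Field F] [Fintype F] [DecidableEq F]
  [Algebra (ZMod p) F] {n : ℕ}

lemma nonempty_fin_equiv {F : Type*} [Field F] [Fintype F] {n : ℕ} (W : Submodule F (Fin n → F)) {k : ℕ}
    (hk : Module.finrank F W = k) : Nonempty (Fin (Fintype.card F ^ k) ≃ W) := by
  classical
  refine ⟨(Fintype.equivFinOfCardEq ?_).symm⟩
  rw [Module.card_eq_pow_finrank (K := F), hk]

/-- The subsystem code with stabilizer code `D = C ∩ C^⊥` and gauge code `C`. -/
theorem existsSubsystemCode_of_code {C D : Submodule F (Fin n → F)}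
    (hD : D = C ⊓ euclideanDual C) :
    ExistsSubsystemCode p F n (n - Module.finrank F C - Module.finrank F D)
      (Module.finrank F C - Module.finrank F D)
      (minWeight ((euclideanDual D : Set (Fin n → F)) \ (C : Set (Fin n → F)))) := by
  have hDC : D ≤ C := hD ▸ inf_le_left
  have hDC' : D ≤ euclideanDual C := hD ▸ inf_le_right
  have hC'D : euclideanDual C ≤ euclideanDual D := euclideanDual_anti hDC
  have hCD : C ≤ euclideanDual D := by
    simpa only [euclideanDual_euclideanDual] using euclideanDual_anti hDC'
  obtain ⟨W, hWC, hW, hDW, hWr⟩ := exists_relative_complement hDC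
  obtain ⟨W', hWC', hW', -, hWr'⟩ := exists_relative_complement hDC'
  rw [finrank_euclideanDual] at hWr'
  obtain ⟨eA⟩ := nonempty_fin_equiv W' hWr'
  obtain ⟨eB⟩ := nonempty_fin_equiv W hWr
  have horth : Orthonormal ℂ fun ij : _ × _ => cosetState D ((eB ij.2 : Fin n → F) + eA ij.1) := by
    refine orthonormal_cosetState fun ij kl h => ?_
    have hB : (eB ij.2 - eB kl.2 : Fin n → F) ∈ W := sub_mem (eB ij.2).2 (eB kl.2).2
    have hA : (eA ij.1 - eA kl.1 : Fin n → F) ∈ W' := sub_mem (eA ij.1).2 (eA kl.1).2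
    rw [add_sub_add_comm] at h
    -- The `W'` part of the difference lies in `C^⊥`, and also in `C` because the rest does; hence
    -- it lies in `D`.
    have hA0 : (eA ij.1 - eA kl.1 : Fin n → F) ∈ D ⊓ W' :=
      ⟨hD.ge ⟨(C.add_mem_iff_right (hWC hB)).1 (hDC h), hWC' hA⟩, hA⟩
    rw [hW', Submodule.mem_bot] at hA0
    have hB0 : (eB ij.2 - eB kl.2 : Fin n → F) ∈ D ⊓ W := ⟨by simpa [hA0] using h, hB⟩
    rw [hW, Submodule.mem_bot] at hB0
    exact Prod.ext (eA.injective (Subtype.ext (sub_eq_zero.1 hA0)))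
      (eB.injective (Subtype.ext (sub_eq_zero.1 hB0)))
  set bA := EuclideanSpace.basisFun (Fin (Fintype.card F ^ (n - Module.finrank F C -
    Module.finrank F D))) ℂ
  set bB := EuclideanSpace.basisFun (Fin (Fintype.card F ^ (Module.finrank F C -
    Module.finrank F D))) ℂ
  obtain ⟨Q, φ, hφ⟩ := exists_tensor_equiv_of_orthonormal bA bB horth
  refine ⟨Q, φ, fun a b hab => ?_⟩
  have hgauge {v : Fin n → F} (hv : v ∈ euclideanDual D)
      (hle : hammingNorm v ≤ symplecticWeight a b) : v ∈ C := by
    by_contra hvC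
    exact (minWeight_le (S := (euclideanDual D : Set (Fin n → F)) \ C) ⟨hv, hvC⟩).not_gt
      ((Nat.cast_le.2 hle).trans_lt hab)
  by_cases hmem : a ∈ euclideanDual D ∧ b ∈ euclideanDual D
  · have ha : a ∈ C := hgauge hmem.1 (hammingNorm_left_le_symplecticWeight a b)
    have hb : b ∈ C := hgauge hmem.2 (hammingNorm_right_le_symplecticWeight a b)
    -- The `D` component `c` of the shift is absorbed by the cosets; only `w` moves labels, and it
    -- moves those of `B`.
    obtain ⟨c, hc, w, hw, rfl⟩ := Submodule.mem_sup.1 (hDW.symm ▸ ha)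
    let G := bB.toBasis.constr ℂ fun j =>
      traceChar p F (b ⬝ᵥ (eB j : Fin n → F)) • bB (eB.symm (eB j + ⟨w, hw⟩))
    refine detectableOn_of_apply_basis bA.toBasis bB.toBasis G fun i j => ?_
    rw [bB.toBasis.constr_basis]
    simp only [OrthonormalBasis.coe_toBasis, TensorProduct.tmul_smul, map_smul,
      Submodule.coe_smul, hφ]
    -- This makes the phase independent of `i`, so that `G` acts on `B` alone.
    have hbA : b ⬝ᵥ (eA i : Fin n → F) = 0 := by
      rw [dotProduct_comm]
      exact hWC' (eA i).2 b hb
    rw [errorOp_cosetState p hmem.2, dotProduct_add, hbA, add_zero]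
    congr 1
    ext x
    refine cosetState_apply_congr ?_
    convert D.neg_mem hc using 1
    simp
    abel
  · rw [not_and_or] at hmem
    refine detectableOn_of_inner_basis_eq_zero bA.toBasis bB.toBasis fun i j i' j' => ?_
    simp only [OrthonormalBasis.coe_toBasis, hφ]
    have hu (i j) : (eB j : Fin n → F) + eA i ∈ euclideanDual D :=
      add_mem (hCD (hWC (eB j).2)) (hC'D (hWC' (eA i).2))
    exact inner_cosetState_errorOp_eq_zero p (hDC.trans hCD) hmem (hu i j) (hu i' j')

end Construction

end QuantumSubsystem

theorem mainTheorem8 (p : ℕ) [Fact p.Prime] (F : Type*) [Field F] [Fintype F] [DecidableEq F]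
    [Algebra (ZMod p) F] (n k' k'' : ℕ) (C₁ C₂ : Submodule F (Fin n → F))
    (hC₂ : C₂ = C₁ ⊓ QuantumSubsystem.euclideanDual C₁)
    (hk' : Module.finrank F C₁ = k') (hk'' : Module.finrank F C₂ = k'')
    (hn : k' + k'' < n) :
    QuantumSubsystem.ExistsSubsystemCode p F n (n - (k' + k'')) (k' - k'')
        (QuantumSubsystem.minWeight
          ((QuantumSubsystem.euclideanDual C₂ : Set (Fin n → F)) \ (C₁ : Set (Fin n → F)))) ∧
      QuantumSubsystem.ExistsSubsystemCode p F n (k' - k'') (n - (k' + k''))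
        (QuantumSubsystem.minWeight
          ((QuantumSubsystem.euclideanDual C₂ : Set (Fin n → F)) \
            (QuantumSubsystem.euclideanDual C₁ : Set (Fin n → F)))) := by
  subst hk' hk''
  constructor
  · rw [Nat.sub_add_eq]
    exact QuantumSubsystem.existsSubsystemCode_of_code p hC₂
  -- Needed for `n - (n - k') = k'` in truncated subtraction.
  · have hle : Module.finrank F C₁ ≤ n := by lia
    have h := QuantumSubsystem.existsSubsystemCode_of_code p
      (C := QuantumSubsystem.euclideanDual C₁) (D := C₂)
      (by rw [QuantumSubsystem.euclideanDual_euclideanDual, inf_comm, hC₂])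
    rwa [QuantumSubsystem.finrank_euclideanDual, Nat.sub_sub_self hle, ← Nat.sub_add_eq] at h
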